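/- Let $\{|j\rangle\}_{j=0}^{2}$ be the computational basis of $\mathbb C^3$, write $|i\pm j\rangle=(|i\rangle\pm|j\rangle)/\sqrt2$, and consider the nine product states on $\mathbb C^3_A\otimes\mathbb C^3_B$ $$|\psi_{1(2)}\rangle=|0\rangle|0\pm1\rangle,\quad |\psi_{3(4)}\rangle=|0\pm1\rangle|2\rangle,\quad |\psi_{5(6)}\rangle=|2\rangle|1\pm2\rangle,\quad |\psi_{7(8)}\rangle=|1\pm2\rangle|0\rangle,\quad |\psi_9\rangle=|1\rangle|1\rangle ,$$ where the upper sign belongs to the first index. Let $\{|k\rangle\}_{k=1}^9$ be the computational basis of $\mathbb C^9$. For $a,b\in\{1,2,3\}$ define operators $\mathbb C^3\to\mathbb C^9$ by the tables (row $a$, column $b$) $$\big(K^{(A)}_{a|b}\big)=\begin{pmatrix}|1\rangle\langle0|&|2\rangle\langle0|&|3\rangle\langle0+1|\\|8\rangle\langle1-2|&|9\rangle\langle1|&|4\rangle\langle0-1|\\|7\rangle\langle1+2|&|6\rangle\langle2|&|5\rangle\langle2|\end{pmatrix},\qquad \big(K^{(B)}_{b|a}\big)=\begin{pmatrix}|1\rangle\langle0+1|&|2\rangle\langle0-1|&|3\rangle\langle2|\\|8\rangle\langle0|&|9\rangle\langle1|&|4\rangle\langle2|\\|7\rangle\langle0|&|6\rangle\langle1-2|&|5\rangle\langle1+2|\end{pmatrix},$$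 and put $\mathcal A_{a|b}(\rho)=K^{(A)}_{a|b}\rho K^{(A)\dagger}_{a|b}$, $\mathcal B_{b|a}(\rho)=K^{(B)}_{b|a}\rho K^{(B)\dagger}_{b|a}$ and $\mathcal M=\sum_{a,b}\mathcal A_{a|b}\otimes\mathcal B_{b|a}$. A quantum instrument is a finite family of completely positive maps whose sum is trace preserving. LOCC* is the set of completely positive trace-preserving (CPTP) maps of the form $\sum p(i_A,i_B|o_A,o_B)\,\mathcal A_{o_A|i_A}\otimes\mathcal B_{o_B|i_B}$ (a finite sum over $i_A,i_B,o_A,o_B$), where $p$ is a conditional probability distribution and $\{\mathcal A_{o_A|i_A}\}_{o_A}$, $\{\mathcal B_{o_B|i_B}\}_{o_B}$ are quantum instruments for all $i_A$, $i_B$. LOCC is the set of maps $$\sum_{o_1,o'_1,\dots,o_N,o'_N}\big(\mathcal A^{(N)}_{o_N|o'_{N-1}}\circ\cdots\circ\mathcal A^{(2)}_{o_2|o'_1}\circ\mathcal A^{(1)}_{o_1}\big)\otimes\big(\mathcal B^{(N)}_{o'_N|o_N}\circ\cdots\circ\mathcal B^{(1)}_{o'_1|o_1}\big)$$ realised by finitely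 many rounds $N$ of local quantum instruments, each conditioned on the last message of the other party, with arbitrary finite-dimensional intermediate systems. A map followed by local measurements perfectly distinguishes the $|\psi_k\rangle$ if there are a POVM of Alice and a POVM of Bob on the output and a function of the two outcomes whose value is $k$ with probability $1$ whenever the input is $|\psi_k\rangle\langle\psi_k|$. Then: 1. The $|\psi_k\rangle$ are orthonormal; $\{\mathcal A_{a|b}\}_a$ is a quantum instrument for every $b$ and $\{\mathcal B_{b|a}\}_b$ is one for every $a$; $\mathcal M(\rho)=\sum_{a,b}(K^{(A)}_{a|b}\otimes K^{(B)}_{b|a})\,\rho\,(K^{(A)}_{a|b}\otimes K^{(B)}_{b|a})^\dagger$; and $\mathcal M$ is CPTP and belongs to LOCC*. 2. For every $k\in\{1,\dots,9\}$, $\mathcal M(|\psi_k\rangle\langle\psi_k|)=|k\rangle\langle k|\otimes|k\rangle\langle k|$. Hence, if Alice and Bob each measure their output of $\mathcal M$ in the computational basis of $\mathbb C^9$, both obtain $k$ with probability $1$; in particular $\mathcal M$ followed by local measurements perfectly distinguishes the nine states. 3. No LOCC map from $\mathbb C^3\otimes\mathbb C^3$ to any $\mathbb C^{a'}\otimes\mathbb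 C^{b'}$, followed by local measurements, perfectly distinguishes the nine states. 4. LOCC is contained in LOCC* for all finite input and output dimensions, and for maps $\mathbb C^3\otimes\mathbb C^3\to\mathbb C^9\otimes\mathbb C^9$ the inclusion is strict; in particular $\mathcal M\in\mathrm{LOCC}^*\setminus\mathrm{LOCC}$. -/

import Mathlib

open scoped Kronecker BigOperators ComplexOrder

noncomputable section

namespace NineState

/-! ### Quantum operations -/

/-- Linear maps from operators on `ℂ^m` to operators on `ℂ^m'`. -/
abbrev SuperOp (m m' : Type) : Type := Matrix m m ℂ →ₗ[ℂ] Matrix m' m' ℂ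

/-- The tensor product `Φ ⊗ Ψ` of two linear maps on operators. -/
def tensorOp {m m' n n' : Type} [Fintype m] [Fintype m'] [Fintype n] [Fintype n']
    [DecidableEq m] [DecidableEq m'] [DecidableEq n] [DecidableEq n']
    (Φ : SuperOp m m') (Ψ : SuperOp n n') : SuperOp (m × n) (m' × n') :=
  (kroneckerLinearEquiv m' m' n' n' ℂ).toLinearMap ∘ₗ TensorProduct.map Φ Ψ ∘ₗ
    (kroneckerLinearEquiv m m n n ℂ).symm.toLinearMap

/-- The defining property of `Φ ⊗ Ψ`. -/
theorem tensorOp_kronecker {m m' n n' : Type} [Fintype m] [Fintype m'] [Fintype n] [Fintype n']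
    [DecidableEq m] [DecidableEq m'] [DecidableEq n] [DecidableEq n']
    (Φ : SuperOp m m') (Ψ : SuperOp n n') (X : Matrix m m ℂ) (Y : Matrix n n ℂ) :
    tensorOp Φ Ψ (X ⊗ₖ Y) = Φ X ⊗ₖ Ψ Y := by
  simp [tensorOp]

/-- Complete positivity: `Φ ⊗ id` preserves positive semidefiniteness for every ancilla `ℂ^k`. -/
def IsCP {m m' : Type} [Fintype m] [Fintype m'] [DecidableEq m] [DecidableEq m']
    (Φ : SuperOp m m') : Prop :=
  ∀ (k : ℕ) (X : Matrix (m × Fin k) (m × Fin k) ℂ), X.PosSemidef →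
    (tensorOp Φ (LinearMap.id : SuperOp (Fin k) (Fin k)) X).PosSemidef

/-- Trace preservation. -/
def IsTP {m m' : Type} [Fintype m] [Fintype m'] (Φ : SuperOp m m') : Prop :=
  ∀ X : Matrix m m ℂ, (Φ X).trace = X.trace

/-- Deterministic quantum operations: completely positive and trace preserving maps. -/
def IsCPTP {m m' : Type} [Fintype m] [Fintype m'] [DecidableEq m] [DecidableEq m']
    (Φ : SuperOp m m') : Prop :=
  IsCP Φ ∧ IsTP Φ

/-- A quantum instrument `{𝓜_o}_o`: completely positive maps, indexed by the classical output `o`,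
whose sum is trace preserving. -/
def IsInstrument {m m' O : Type} [Fintype m] [Fintype m'] [DecidableEq m] [DecidableEq m']
    [Fintype O] (𝓜 : O → SuperOp m m') : Prop :=
  (∀ o, IsCP (𝓜 o)) ∧ IsTP (∑ o, 𝓜 o)

/-- The map `ρ ↦ K ρ K†` with the single Kraus operator `K`. -/
def krausOp {m m' : Type} [Fintype m] (K : Matrix m' m ℂ) : SuperOp m m' where
  toFun X := K * X * K.conjTranspose
  map_add' X Y := by rw [Matrix.mul_add, Matrix.add_mul]
  map_smul' c X := by simp

/-! ### LOCC and LOCC* -/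

/-- `LOCCBranches a b a' b' c Φ` says that `Φ 0, …, Φ (c - 1)` are the branches of a finite
alternating protocol on `ℂ^a ⊗ ℂ^b` after some number of complete rounds: the local systems are
then `ℂ^a'` and `ℂ^b'`, and `Φ x` is the (unnormalised) joint operation, summed over all earlier
classical messages, when the last message sent by Bob is `x`.

In every round, Alice receives Bob's last message `x` and applies an instrument `{𝓐_{o|x}}_o`
chosen by it; Bob receives `o` and applies an instrument `{𝓑_{o'|o}}_{o'}`, whose output `o'` is
the next message to Alice. Earlier messages may be stored in the local systems, whose dimension is
unrestricted. Before the first round there is one trivial message. After `N` rounds,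
`∑ x, Φ x` is the sum over `o_1, o'_1, …, o_N, o'_N` of
`(𝓐⁽ᴺ⁾_{o_N|o'_{N-1}} ∘ ⋯ ∘ 𝓐⁽¹⁾_{o_1}) ⊗ (𝓑⁽ᴺ⁾_{o'_N|o_N} ∘ ⋯ ∘ 𝓑⁽¹⁾_{o'_1|o_1})`. -/
inductive LOCCBranches (a b : ℕ) : (a' b' c : ℕ) →
    (Fin c → SuperOp (Fin a × Fin b) (Fin a' × Fin b')) → Prop
  | init : LOCCBranches a b a b 1 (fun _ => LinearMap.id)
  | round {a₁ b₁ c₁ a₂ b₂ c₂ d : ℕ}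
      {Φ : Fin c₁ → SuperOp (Fin a × Fin b) (Fin a₁ × Fin b₁)}
      (hΦ : LOCCBranches a b a₁ b₁ c₁ Φ)
      (𝓐 : Fin c₁ → Fin d → SuperOp (Fin a₁) (Fin a₂))
      (h𝓐 : ∀ x, IsInstrument (𝓐 x))
      (𝓑 : Fin d → Fin c₂ → SuperOp (Fin b₁) (Fin b₂))
      (h𝓑 : ∀ o, IsInstrument (𝓑 o)) :
      LOCCBranches a b a₂ b₂ c₂
        (fun o' => ∑ x, ∑ o, tensorOp (𝓐 x o) (𝓑 o o') ∘ₗ Φ x)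

/-- Finite-round LOCC from `ℂ^a ⊗ ℂ^b` to `ℂ^a' ⊗ ℂ^b'`: the joint operations obtained from such a
protocol by discarding the last message. -/
def LOCC (a b a' b' : ℕ) : Set (SuperOp (Fin a × Fin b) (Fin a' × Fin b')) :=
  {M | ∃ (c : ℕ) (Φ : Fin c → SuperOp (Fin a × Fin b) (Fin a' × Fin b')),
    LOCCBranches a b a' b' c Φ ∧ M = ∑ x, Φ x}

/-- A conditional probability distribution `p(i_A, i_B | o_A, o_B)`, written `p oA oB iA iB`. -/
def IsCondProb {OA OB IA IB : Type} [Fintype IA] [Fintype IB]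
    (p : OA → OB → IA → IB → ℝ) : Prop :=
  (∀ oA oB iA iB, 0 ≤ p oA oB iA iB) ∧ ∀ oA oB, ∑ iA, ∑ iB, p oA oB iA iB = 1

/-- LOCC*: the CPTP maps of the form
`∑ p(i_A, i_B | o_A, o_B) 𝓐_{o_A|i_A} ⊗ 𝓑_{o_B|i_B}`, where `p` is a conditional probability
distribution and `{𝓐_{o_A|i_A}}_{o_A}`, `{𝓑_{o_B|i_B}}_{o_B}` are quantum instruments conditioned by
classical inputs. -/
def LOCCStar (a b a' b' : ℕ) : Set (SuperOp (Fin a × Fin b) (Fin a' × Fin b')) :=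
  {M | IsCPTP M ∧
    ∃ (IA IB OA OB : Type) (_ : Fintype IA) (_ : Fintype IB) (_ : Fintype OA) (_ : Fintype OB)
      (p : OA → OB → IA → IB → ℝ)
      (𝓐 : IA → OA → SuperOp (Fin a) (Fin a')) (𝓑 : IB → OB → SuperOp (Fin b) (Fin b')),
      IsCondProb p ∧ (∀ i, IsInstrument (𝓐 i)) ∧ (∀ i, IsInstrument (𝓑 i)) ∧
      M = ∑ iA, ∑ iB, ∑ oA, ∑ oB, (p oA oB iA iB : ℂ) • tensorOp (𝓐 iA oA) (𝓑 iB oB)}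

/-! ### State discrimination by a joint operation followed by local measurements -/

/-- The operator `|v⟩⟨v|`. -/
def proj {m : Type} (v : m → ℂ) : Matrix m m ℂ := Matrix.vecMulVec v (star v)

/-- A measurement (POVM) with outcomes in `X`. -/
def IsPOVM {m X : Type} [Fintype m] [DecidableEq m] [Fintype X] (E : X → Matrix m m ℂ) : Prop :=
  (∀ x, (E x).PosSemidef) ∧ ∑ x, E x = 1

/-- `M` followed by local measurements of Alice and Bob identifies the states `ψ k` perfectly:
there are local measurements `E`, `F` and a guess `g x y` computed from the two outcomes such that,
for every `k`, the guess is `k` with probability one when the input is `|ψ k⟩⟨ψ k|`. -/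
def LocallyDiscriminates {n : ℕ} {m : Type} {a' b' : ℕ}
    (M : SuperOp m (Fin a' × Fin b')) (ψ : Fin n → m → ℂ) : Prop :=
  ∃ (X Y : Type) (_ : Fintype X) (_ : Fintype Y)
    (E : X → Matrix (Fin a') (Fin a') ℂ) (F : Y → Matrix (Fin b') (Fin b') ℂ) (g : X → Y → Fin n),
    IsPOVM E ∧ IsPOVM F ∧
    ∀ k, ∑ x, ∑ y, (if g x y = k then ((E x ⊗ₖ F y) * M (proj (ψ k))).trace else 0) = 1

/-! ### The nine states and the looped operation -/

/-- The computational basis vector `|j⟩` of `ℂ^d`. -/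
def ket {d : ℕ} (j : Fin d) : Fin d → ℂ := Pi.single j 1

/-- `|i + j⟩ = (|i⟩ + |j⟩) / √2`. -/
def ketAdd (i j : Fin 3) : Fin 3 → ℂ := ((Real.sqrt 2 : ℝ) : ℂ)⁻¹ • (ket i + ket j)

/-- `|i - j⟩ = (|i⟩ - |j⟩) / √2`. -/
def ketSub (i j : Fin 3) : Fin 3 → ℂ := ((Real.sqrt 2 : ℝ) : ℂ)⁻¹ • (ket i - ket j)

/-- The product vector `|u⟩_A |v⟩_B`. -/
def prodKet (u v : Fin 3 → ℂ) : Fin 3 × Fin 3 → ℂ := fun q => u q.1 * v q.2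

/-- The nine product states; `nineStates k` is `|ψ_{k+1}⟩`, with `k = 0, …, 8`. -/
def nineStates : Fin 9 → Fin 3 × Fin 3 → ℂ :=
  ![prodKet (ket 0) (ketAdd 0 1), prodKet (ket 0) (ketSub 0 1),
    prodKet (ketAdd 0 1) (ket 2), prodKet (ketSub 0 1) (ket 2),
    prodKet (ket 2) (ketAdd 1 2), prodKet (ket 2) (ketSub 1 2),
    prodKet (ketAdd 1 2) (ket 0), prodKet (ketSub 1 2) (ket 0),
    prodKet (ket 1) (ket 1)]

/-- The operator `|k⟩⟨v|` from `ℂ^3` to `ℂ^9`. The basis vectors of `ℂ^9`, labelled `1, …, 9` in the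
mathematical text, are labelled `0, …, 8` here. -/
def outer (k : Fin 9) (v : Fin 3 → ℂ) : Matrix (Fin 9) (Fin 3) ℂ :=
  Matrix.vecMulVec (ket k) (star v)

/-- Alice's Kraus operators `K_{a|b}` (row `a`, column `b`). -/
def aliceKraus : Fin 3 → Fin 3 → Matrix (Fin 9) (Fin 3) ℂ :=
  ![![outer 0 (ket 0), outer 1 (ket 0), outer 2 (ketAdd 0 1)],
    ![outer 7 (ketSub 1 2), outer 8 (ket 1), outer 3 (ketSub 0 1)],
    ![outer 6 (ketAdd 1 2), outer 5 (ket 2), outer 4 (ket 2)]]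

/-- Bob's Kraus operators `K_{b|a}` (row `a`, column `b`). -/
def bobKraus : Fin 3 → Fin 3 → Matrix (Fin 9) (Fin 3) ℂ :=
  ![![outer 0 (ketAdd 0 1), outer 1 (ketSub 0 1), outer 2 (ket 2)],
    ![outer 7 (ket 0), outer 8 (ket 1), outer 3 (ket 2)],
    ![outer 6 (ket 0), outer 5 (ketSub 1 2), outer 4 (ketAdd 1 2)]]

/-- Alice's local operation `𝓐_{a|b}`, with classical input `b` and classical output `a`. -/
def aliceOp (b a : Fin 3) : SuperOp (Fin 3) (Fin 9) := krausOp (aliceKraus a b)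

/-- Bob's local operation `𝓑_{b|a}`, with classical input `a` and classical output `b`. -/
def bobOp (a b : Fin 3) : SuperOp (Fin 3) (Fin 9) := krausOp (bobKraus a b)

/-- The looped operation `∑_{a,b} 𝓐_{a|b} ⊗ 𝓑_{b|a}`. -/
def nineStateMap : SuperOp (Fin 3 × Fin 3) (Fin 9 × Fin 9) :=
  ∑ a, ∑ b, tensorOp (aliceOp b a) (bobOp a b)

end NineState

end

/-!
The looped operation works because the local Kraus operators combine: with `k` the common label of
`aliceKraus a b` and `bobKraus a b`, their tensor product is `|k⟩|k⟩⟨ψ_k|` (`nineStateMap_eq`). So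
the operation measures in the orthonormal basis of the nine states and hands the outcome to both
parties.

LOCC is contained in LOCC* because the transcript of a finite protocol can serve as classical input
and output: for fixed messages of Bob, Alice's composed operations form an instrument indexed by her
own messages, and conversely (`LOCCBranches.exists_transcripts`). The distribution `p` then feeds
each party's outputs to the other one. Complete positivity of the resulting joint map goes through
Kraus operators, which exist by Choi's theorem (`IsCP.exists_kraus`).

Nonlocality without entanglement comes from the rigidity of the nine states: a local effect that
keeps them pairwise orthogonal is a multiple of the identity (`isTraceMultiple_alice`,
`isTraceMultiple_bob`). In a protocol that discriminates perfectly, every intermediate outcome must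
keep the states orthogonal, since orthogonality cannot be restored later. Effects and continuations
of a protocol are treated as positive linear functionals. If a continuation never makes the guess
`k` on `ψ_j` for `j ≠ k`, then Cauchy–Schwarz makes its functionals vanish on `|ψ_j⟩⟨ψ_l|` for
`j ≠ l`, and summing over the guesses gives orthogonality (`sum_cross_eq_zero`). By induction on the
rounds, with the round just performed absorbed into the continuation, every branch is a sum of
products of operations with trivial effects (`LOCCBranches.exists_trivial_terms`). The same argument
applied to the final local measurements shows that the outcome carries no information.
-/

namespace NineState

open Matrix

/-! ### Linear maps on operators -/

theorem kronecker_sum_left {m m' n n' ι : Type*} (s : Finset ι) (X : ι → Matrix m m' ℂ)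
    (Y : Matrix n n' ℂ) : (∑ i ∈ s, X i) ⊗ₖ Y = ∑ i ∈ s, X i ⊗ₖ Y := by
  ext ⟨i, j⟩ ⟨k, l⟩
  simp [Matrix.sum_apply, Finset.sum_mul]

theorem kronecker_sum_right {m m' n n' ι : Type*} (s : Finset ι) (X : Matrix m m' ℂ)
    (Y : ι → Matrix n n' ℂ) : X ⊗ₖ (∑ i ∈ s, Y i) = ∑ i ∈ s, X ⊗ₖ Y i := by
  ext ⟨i, j⟩ ⟨k, l⟩
  simp [Matrix.sum_apply, Finset.mul_sum]

@[simp] theorem krausOp_apply {m m' : Type} [Fintype m] (K : Matrix m' m ℂ) (X : Matrix m m ℂ) :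
    krausOp K X = K * X * Kᴴ := rfl

theorem isTP_sum_krausOp {m m' ι : Type} [Fintype m] [Fintype m'] [DecidableEq m] [Fintype ι]
    {K : ι → Matrix m' m ℂ} (h : ∑ i, (K i)ᴴ * K i = 1) : IsTP (∑ i, krausOp (K i)) := fun X => by
  rw [LinearMap.sum_apply, Matrix.trace_sum]
  simp only [krausOp_apply, Matrix.trace_mul_comm _ (K _)ᴴ, ← Matrix.mul_assoc]
  rw [← Matrix.trace_sum, ← Matrix.sum_mul, h, Matrix.one_mul]

section Operators

variable {m m' m'' n n' n'' : Type} [Fintype m] [Fintype m'] [Fintype m''] [Fintype n] [Fintype n']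
  [Fintype n''] [DecidableEq m] [DecidableEq m'] [DecidableEq m''] [DecidableEq n] [DecidableEq n']
  [DecidableEq n'']

/-- Product operators span, so a linear map on a bipartite operator space is determined by its
values on them. -/
theorem linearMap_ext_kronecker {V : Type*} [AddCommGroup V] [Module ℂ V]
    {f g : Matrix (m × n) (m × n) ℂ →ₗ[ℂ] V}
    (h : ∀ (X : Matrix m m ℂ) (Y : Matrix n n ℂ), f (X ⊗ₖ Y) = g (X ⊗ₖ Y)) : f = g := by
  have key : f ∘ₗ (kroneckerLinearEquiv m m n n ℂ).toLinearMap =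
      g ∘ₗ (kroneckerLinearEquiv m m n n ℂ).toLinearMap :=
    TensorProduct.ext' fun X Y => by simpa using h X Y
  ext1 Z
  simpa using LinearMap.congr_fun key ((kroneckerLinearEquiv m m n n ℂ).symm Z)

theorem tensorOp_comp (Φ : SuperOp m m') (Φ' : SuperOp m' m'') (Ψ : SuperOp n n')
    (Ψ' : SuperOp n' n'') :
    tensorOp (Φ' ∘ₗ Φ) (Ψ' ∘ₗ Ψ) = tensorOp Φ' Ψ' ∘ₗ tensorOp Φ Ψ :=
  linearMap_ext_kronecker fun X Y => by simp [tensorOp_kronecker]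

@[simp] theorem tensorOp_id_id :
    tensorOp (LinearMap.id : SuperOp m m) (LinearMap.id : SuperOp n n) = LinearMap.id :=
  linearMap_ext_kronecker fun X Y => by simp [tensorOp_kronecker]

@[simp] theorem tensorOp_zero_left (Ψ : SuperOp n n') : tensorOp (0 : SuperOp m m') Ψ = 0 :=
  linearMap_ext_kronecker fun X Y => by simp [tensorOp_kronecker]

@[simp] theorem tensorOp_zero_right (Φ : SuperOp m m') : tensorOp Φ (0 : SuperOp n n') = 0 :=
  linearMap_ext_kronecker fun X Y => by simp [tensorOp_kronecker]

theorem tensorOp_sum_left {ι : Type*} (s : Finset ι) (Φ : ι → SuperOp m m') (Ψ : SuperOp n n') :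
    tensorOp (∑ i ∈ s, Φ i) Ψ = ∑ i ∈ s, tensorOp (Φ i) Ψ :=
  linearMap_ext_kronecker fun X Y => by
    simp [tensorOp_kronecker, kronecker_sum_left]

theorem tensorOp_sum_right {ι : Type*} (s : Finset ι) (Φ : SuperOp m m') (Ψ : ι → SuperOp n n') :
    tensorOp Φ (∑ i ∈ s, Ψ i) = ∑ i ∈ s, tensorOp Φ (Ψ i) :=
  linearMap_ext_kronecker fun X Y => by
    simp [tensorOp_kronecker, kronecker_sum_right]

/-! ### Kraus representations -/

theorem tensorOp_krausOp (K : Matrix m' m ℂ) (L : Matrix n' n ℂ) :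
    tensorOp (krausOp K) (krausOp L) = krausOp (K ⊗ₖ L) :=
  linearMap_ext_kronecker fun X Y => by
    rw [tensorOp_kronecker]
    simp [conjTranspose_kronecker, mul_kronecker_mul]

theorem IsCP.sum {ι : Type*} {s : Finset ι} {Φ : ι → SuperOp m m'} (h : ∀ i ∈ s, IsCP (Φ i)) :
    IsCP (∑ i ∈ s, Φ i) := fun k X hX => by
  rw [tensorOp_sum_left, LinearMap.sum_apply]
  exact posSemidef_sum _ fun i hi => h i hi k X hX

theorem IsCP.comp {Φ : SuperOp m m'} {Ψ : SuperOp m' m''} (hΨ : IsCP Ψ) (hΦ : IsCP Φ) :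
    IsCP (Ψ ∘ₗ Φ) := fun k X hX => by
  rw [← LinearMap.id_comp (LinearMap.id : SuperOp (Fin k) (Fin k)), tensorOp_comp]
  exact hΨ k _ (hΦ k X hX)

theorem isCP_krausOp (K : Matrix m' m ℂ) : IsCP (krausOp K) := fun k X hX => by
  have hid : (LinearMap.id : SuperOp (Fin k) (Fin k)) = krausOp 1 := by
    ext1 Y
    simp
  rw [hid, tensorOp_krausOp]
  exact hX.mul_mul_conjTranspose_same _

theorem isCP_id : IsCP (LinearMap.id : SuperOp m m) := fun k X hX => by
  simpa using hX

open scoped MatrixOrder Matrix.Norms.L2Operator in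
theorem _root_.Matrix.PosSemidef.exists_conjTranspose_mul_self {A : Matrix m m ℂ}
    (hA : A.PosSemidef) : ∃ B : Matrix m m ℂ, A = Bᴴ * B := by
  obtain ⟨B, hB⟩ := CStarAlgebra.nonneg_iff_eq_star_mul_self.mp hA.nonneg
  exact ⟨B, by simpa [star_eq_conjTranspose] using hB⟩

/-- Choi's theorem: a factorisation `Bᴴ * B` of the image of the unnormalised maximally entangled
operator `∑ i j, |i⟩⟨j| ⊗ |i⟩⟨j|` yields Kraus operators, the rows of `B` read as matrices. -/
theorem IsCP.exists_kraus {a : ℕ} {Φ : SuperOp (Fin a) m'} (hΦ : IsCP Φ) :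
    ∃ K : m' × Fin a → Matrix m' (Fin a) ℂ, Φ = ∑ r, krausOp (K r) := by
  let e : Fin a × Fin a → ℂ := fun q => if q.1 = q.2 then 1 else 0
  have he : vecMulVec e (star e) =
      ∑ i, ∑ j, Matrix.single i j (1 : ℂ) ⊗ₖ Matrix.single i j (1 : ℂ) := by
    ext ⟨p, q⟩ ⟨r, s⟩
    simp only [vecMulVec_apply, Matrix.sum_apply, kronecker_apply, Matrix.single_apply, e, ite_and]
    by_cases h₁ : p = q <;> by_cases h₂ : r = s <;> simp [h₁, h₂, eq_comm]
  obtain ⟨B, hB⟩ := (hΦ a _ (posSemidef_vecMulVec_self_star e)).exists_conjTranspose_mul_self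
  rw [he] at hB
  simp only [map_sum, tensorOp_kronecker, LinearMap.id_apply] at hB
  refine ⟨fun r => Matrix.of fun p i => star (B r (p, i)), ?_⟩
  refine Matrix.ext_linearMap _ fun i j => LinearMap.ext_ring ?_
  ext p q
  have h := congrFun (congrFun hB (p, i)) (q, j)
  simp only [Matrix.sum_apply, kronecker_apply, Matrix.single_apply, ite_and, mul_ite, mul_one,
    mul_zero] at h
  simpa [Matrix.sum_apply, Matrix.mul_apply, Matrix.single_apply, ite_and] using h

theorem IsCP.tensorOp {a b : ℕ} {Φ : SuperOp (Fin a) m'} {Ψ : SuperOp (Fin b) n'} (hΦ : IsCP Φ)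
    (hΨ : IsCP Ψ) : IsCP (tensorOp Φ Ψ) := by
  obtain ⟨K, rfl⟩ := hΦ.exists_kraus
  obtain ⟨L, rfl⟩ := hΨ.exists_kraus
  rw [tensorOp_sum_left]
  refine IsCP.sum fun r _ => ?_
  rw [tensorOp_sum_right]
  refine IsCP.sum fun s _ => ?_
  rw [tensorOp_krausOp]
  exact isCP_krausOp _

theorem IsCP.posSemidef {Φ : SuperOp m m'} (hΦ : IsCP Φ) {X : Matrix m m ℂ}
    (hX : X.PosSemidef) : (Φ X).PosSemidef := by
  have h := hΦ 1 (X ⊗ₖ 1) (hX.kronecker PosSemidef.one)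
  rw [tensorOp_kronecker] at h
  convert h.submatrix (fun p : m' => (p, (0 : Fin 1))) using 1
  ext p q
  simp

/-- A completely positive map of vanishing trace vanishes. -/
theorem IsCP.eq_zero_of_trace_eq_zero {a : ℕ} {Φ : SuperOp (Fin a) m'} (hΦ : IsCP Φ)
    (h : (Φ 1).trace = 0) : Φ = 0 := by
  obtain ⟨K, rfl⟩ := hΦ.exists_kraus
  rw [LinearMap.sum_apply, Matrix.trace_sum] at h
  refine Finset.sum_eq_zero fun r hr => ?_
  have h0 := (Finset.sum_eq_zero_iff_of_nonneg fun r _ =>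
    (PosSemidef.one.mul_mul_conjTranspose_same (K r)).trace_nonneg).1 h r hr
  have hK : K r = 0 := by simpa [trace_mul_conjTranspose_self_eq_zero_iff] using h0
  ext1 X
  simp [hK]

/-! ### Trace preservation and instruments -/

theorem IsInstrument.sum_trace {O : Type} [Fintype O] {𝓜 : O → SuperOp m m'}
    (h : IsInstrument 𝓜) (X : Matrix m m ℂ) : ∑ o, (𝓜 o X).trace = X.trace := by
  rw [← h.2 X, LinearMap.sum_apply, Matrix.trace_sum]

theorem IsInstrument.of_sum_trace {O : Type} [Fintype O] {𝓜 : O → SuperOp m m'}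
    (hcp : ∀ o, IsCP (𝓜 o)) (h : ∀ X, ∑ o, (𝓜 o X).trace = X.trace) : IsInstrument 𝓜 :=
  ⟨hcp, fun X => by rw [← h X, LinearMap.sum_apply, Matrix.trace_sum]⟩

/-- Running an instrument whose choice depends on the outcome of a previous one. -/
theorem IsInstrument.comp {O O' : Type} [Fintype O] [Fintype O'] {𝓜 : O → SuperOp m m'}
    {𝓝 : O → O' → SuperOp m' m''} (h : IsInstrument 𝓜) (h' : ∀ o, IsInstrument (𝓝 o)) :
    IsInstrument fun q : O × O' => 𝓝 q.1 q.2 ∘ₗ 𝓜 q.1 :=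
  .of_sum_trace (fun q => ((h' q.1).1 q.2).comp (h.1 q.1)) fun X => by
    simp only [Fintype.sum_prod_type, LinearMap.comp_apply, (h' _).sum_trace, h.sum_trace]

/-- If Bob's instrument is chosen by the outcome of Alice's, their joint operation preserves traces. -/
theorem sum_trace_tensorOp {O O' : Type} [Fintype O] [Fintype O'] {𝓐 : O → SuperOp m m'}
    {𝓑 : O → O' → SuperOp n n'} (hA : IsInstrument 𝓐) (hB : ∀ o, IsInstrument (𝓑 o))
    (Z : Matrix (m × n) (m × n) ℂ) :
    ∑ o, ∑ o', (tensorOp (𝓐 o) (𝓑 o o') Z).trace = Z.trace := by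
  have : ∑ o, ∑ o', Matrix.traceLinearMap _ ℂ ℂ ∘ₗ tensorOp (𝓐 o) (𝓑 o o') =
      Matrix.traceLinearMap (m × n) ℂ ℂ :=
    linearMap_ext_kronecker fun X Y => by
      simp [tensorOp_kronecker, trace_kronecker, ← Finset.mul_sum, ← Finset.sum_mul,
        (hB _).sum_trace, hA.sum_trace]
  simpa using LinearMap.congr_fun this Z

end Operators

/-! ### LOCC is contained in LOCC* -/

variable {a b a' b' c : ℕ}

theorem LOCCBranches.isCP {Φ : Fin c → SuperOp (Fin a × Fin b) (Fin a' × Fin b')}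
    (h : LOCCBranches a b a' b' c Φ) (x : Fin c) : IsCP (Φ x) := by
  induction h with
  | init => exact isCP_id
  | round _ 𝓐 h𝓐 𝓑 h𝓑 ih =>
    exact IsCP.sum fun x _ => IsCP.sum fun o _ =>
      (((h𝓐 x).1 o).tensorOp ((h𝓑 o).1 _)).comp (ih x)

theorem LOCCBranches.sum_trace {Φ : Fin c → SuperOp (Fin a × Fin b) (Fin a' × Fin b')}
    (h : LOCCBranches a b a' b' c Φ) (Z : Matrix (Fin a × Fin b) (Fin a × Fin b) ℂ) :
    ∑ x, (Φ x Z).trace = Z.trace := by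
  induction h with
  | init => simp
  | round _ 𝓐 h𝓐 𝓑 h𝓑 ih =>
    simp only [LinearMap.sum_apply, Matrix.trace_sum, LinearMap.comp_apply]
    rw [Finset.sum_comm, ← ih]
    refine Finset.sum_congr rfl fun x _ => ?_
    rw [Finset.sum_comm, sum_trace_tensorOp (h𝓐 x) h𝓑]

/-- The branches of a protocol in terms of full transcripts. Alice's composed operations, indexed
by her messages `oA`, form an instrument for every fixed list `oB` of Bob's messages, and vice
versa; `last` extracts Bob's last message. -/
theorem LOCCBranches.exists_transcripts {Φ : Fin c → SuperOp (Fin a × Fin b) (Fin a' × Fin b')}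
    (h : LOCCBranches a b a' b' c Φ) :
    ∃ (OA OB : Type) (_ : Fintype OA) (_ : Fintype OB) (last : OB → Fin c)
      (𝓐 : OB → OA → SuperOp (Fin a) (Fin a')) (𝓑 : OA → OB → SuperOp (Fin b) (Fin b')),
      (∀ oB, IsInstrument (𝓐 oB)) ∧ (∀ oA, IsInstrument (𝓑 oA)) ∧
      ∀ x, Φ x = ∑ oA, ∑ oB, if last oB = x then tensorOp (𝓐 oB oA) (𝓑 oA oB) else 0 := by
  induction h with
  | init =>
    have hid : ∀ k : ℕ, IsInstrument fun _ : Unit => (LinearMap.id : SuperOp (Fin k) (Fin k)) :=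
      fun k => ⟨fun _ => isCP_id, fun X => by simp⟩
    exact ⟨Unit, Unit, inferInstance, inferInstance, fun _ => 0, fun _ _ => LinearMap.id,
      fun _ _ => LinearMap.id, fun _ => hid _, fun _ => hid _, fun x => by
        simp [Subsingleton.elim x 0]⟩
  | @round a₁ b₁ c₁ a₂ b₂ c₂ d Φ _ 𝓐r h𝓐r 𝓑r h𝓑r ih =>
    obtain ⟨OA, OB, _, _, last, 𝓐, 𝓑, h𝓐, h𝓑, hΦ⟩ := ih
    refine ⟨OA × Fin d, OB × Fin c₂, inferInstance, inferInstance, fun q => q.2,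
      fun q r => 𝓐r (last q.1) r.2 ∘ₗ 𝓐 q.1 r.1, fun r q => 𝓑r r.2 q.2 ∘ₗ 𝓑 r.1 q.1,
      fun q => IsInstrument.comp (𝓝 := fun _ => 𝓐r (last q.1)) (h𝓐 q.1) fun _ => h𝓐r (last q.1),
      fun r => IsInstrument.comp (𝓝 := fun _ => 𝓑r r.2) (h𝓑 r.1) fun _ => h𝓑r r.2, fun o' => ?_⟩
    have hstep : ∀ x o, tensorOp (𝓐r x o) (𝓑r o o') ∘ₗ Φ x =
        ∑ oA, ∑ oB, if last oB = x then
          tensorOp (𝓐r (last oB) o ∘ₗ 𝓐 oB oA) (𝓑r o o' ∘ₗ 𝓑 oA oB) else 0 := by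
      intro x o
      rw [hΦ x]
      ext1 Z
      simp only [LinearMap.comp_apply, LinearMap.sum_apply, map_sum]
      refine Finset.sum_congr rfl fun oA _ => Finset.sum_congr rfl fun oB _ => ?_
      split_ifs with hx
      · rw [tensorOp_comp, hx, LinearMap.comp_apply]
      · simp
    simp only [hstep, Fintype.sum_prod_type, Finset.sum_ite_eq', Finset.mem_univ, if_true]
    rw [Finset.sum_comm, Finset.sum_comm (s := (Finset.univ : Finset OA))]
    refine Finset.sum_congr rfl fun o _ => ?_
    rw [Finset.sum_comm]
    refine Finset.sum_congr rfl fun oA _ => ?_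
    rw [Finset.sum_comm]
    simp

theorem LOCC_subset_LOCCStar (a b a' b' : ℕ) : LOCC a b a' b' ⊆ LOCCStar a b a' b' := by
  rintro _ ⟨c, Φ, h, rfl⟩
  obtain ⟨OA, OB, _, _, last, 𝓐, 𝓑, h𝓐, h𝓑, hΦ⟩ := h.exists_transcripts
  classical
  refine ⟨⟨IsCP.sum fun x _ => h.isCP x, fun X => ?_⟩, OB, OA, OA, OB, inferInstance, inferInstance,
    inferInstance, inferInstance, fun oA oB iA iB => if iA = oB ∧ iB = oA then 1 else 0, 𝓐, 𝓑,
    ⟨fun oA oB iA iB => by dsimp only; split_ifs <;> norm_num, fun oA oB => by simp [ite_and]⟩,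
    h𝓐, h𝓑, ?_⟩
  · rw [LinearMap.sum_apply, Matrix.trace_sum, h.sum_trace]
  · simp only [hΦ, apply_ite Complex.ofReal, Complex.ofReal_one, Complex.ofReal_zero, ite_smul,
      one_smul, zero_smul, ite_and, Finset.sum_ite_eq, Finset.mem_univ, if_true]
    trans ∑ oA, ∑ oB, tensorOp (𝓐 oB oA) (𝓑 oA oB)
    · rw [Finset.sum_comm]
      refine Finset.sum_congr rfl fun oA _ => ?_
      rw [Finset.sum_comm]
      simp
    · exact Finset.sum_comm

/-! ### The nine states and the looped operation -/

/-- Alice's factor of the product state `nineStates k`. -/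
noncomputable def aliceFactor : Fin 9 → Fin 3 → ℂ :=
  ![ket 0, ket 0, ketAdd 0 1, ketSub 0 1, ket 2, ket 2, ketAdd 1 2, ketSub 1 2, ket 1]

/-- Bob's factor of the product state `nineStates k`. -/
noncomputable def bobFactor : Fin 9 → Fin 3 → ℂ :=
  ![ketAdd 0 1, ketSub 0 1, ket 2, ket 2, ketAdd 1 2, ketSub 1 2, ket 0, ket 0, ket 1]

/-- The common label of the Kraus operators `aliceKraus a b` and `bobKraus a b`. -/
def krausLabel : Fin 3 → Fin 3 → Fin 9 := ![![0, 1, 2], ![7, 8, 3], ![6, 5, 4]]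

theorem nineStates_eq (k : Fin 9) : nineStates k = prodKet (aliceFactor k) (bobFactor k) := by
  fin_cases k <;> rfl

theorem aliceKraus_eq (a b : Fin 3) :
    aliceKraus a b = outer (krausLabel a b) (aliceFactor (krausLabel a b)) := by
  fin_cases a <;> fin_cases b <;> rfl

theorem bobKraus_eq (a b : Fin 3) :
    bobKraus a b = outer (krausLabel a b) (bobFactor (krausLabel a b)) := by
  fin_cases a <;> fin_cases b <;> rfl

theorem sum_krausLabel {V : Type*} [AddCommMonoid V] (f : Fin 9 → V) :
    ∑ a, ∑ b, f (krausLabel a b) = ∑ k, f k := by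
  rw [← Fintype.sum_prod_type']
  exact Fintype.sum_bijective (fun q : Fin 3 × Fin 3 => krausLabel q.1 q.2) (by decide) _ _
    fun _ => rfl

theorem star_prodKet_dotProduct (u v u' v' : Fin 3 → ℂ) :
    star (prodKet u v) ⬝ᵥ prodKet u' v' = (star u ⬝ᵥ u') * (star v ⬝ᵥ v') := by
  simp only [dotProduct, prodKet, Fintype.sum_prod_type, Pi.star_apply, star_mul',
    Finset.sum_mul_sum]
  exact Finset.sum_congr rfl fun i _ => Finset.sum_congr rfl fun j _ => by ring

theorem vecMulVec_prodKet (u v u' v' : Fin 3 → ℂ) :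
    vecMulVec (prodKet u v) (star (prodKet u' v')) =
      vecMulVec u (star u') ⊗ₖ vecMulVec v (star v') := by
  ext ⟨i, j⟩ ⟨k, l⟩
  simp [vecMulVec_apply, prodKet]
  ring

theorem inv_sqrt_two_mul_self :
    ((Real.sqrt 2 : ℝ) : ℂ)⁻¹ * ((Real.sqrt 2 : ℝ) : ℂ)⁻¹ = 1 / 2 := by
  rw [← mul_inv, ← Complex.ofReal_mul, Real.mul_self_sqrt (by norm_num)]
  norm_num

theorem nineStates_orthonormal (j k : Fin 9) :
    star (nineStates j) ⬝ᵥ nineStates k = if j = k then 1 else 0 := by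
  rw [nineStates_eq, nineStates_eq, star_prodKet_dotProduct]
  have h2 := inv_sqrt_two_mul_self
  generalize hr : ((Real.sqrt 2 : ℝ) : ℂ)⁻¹ = r at h2
  have hs : starRingEnd ℂ r = r := by rw [← hr]; simp
  fin_cases j <;> fin_cases k <;>
    simp [aliceFactor, bobFactor, ketAdd, ketSub, ket, hr, hs, dotProduct, Fin.sum_univ_three,
      Pi.single_apply, h2] <;> norm_num

@[simp] theorem star_ket {d : ℕ} (j : Fin d) : star (ket j) = ket j := by
  ext i
  simp [ket, Pi.single_apply, apply_ite star]

theorem ket_dotProduct_ket {d : ℕ} (i j : Fin d) : ket i ⬝ᵥ ket j = if i = j then 1 else 0 := by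
  simp [ket, Pi.single_apply, eq_comm]

theorem conjTranspose_outer_mul_outer (k : Fin 9) (v : Fin 3 → ℂ) :
    (outer k v)ᴴ * outer k v = proj v := by
  simp [outer, proj, conjTranspose_vecMulVec, vecMulVec_mul_vecMulVec, ket_dotProduct_ket]

theorem isInstrument_aliceOp (b : Fin 3) : IsInstrument (aliceOp b) := by
  refine ⟨fun a => isCP_krausOp _, isTP_sum_krausOp ?_⟩
  simp only [aliceKraus_eq, conjTranspose_outer_mul_outer]
  have h2 := inv_sqrt_two_mul_self
  generalize hr : ((Real.sqrt 2 : ℝ) : ℂ)⁻¹ = r at h2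
  have hs : starRingEnd ℂ r = r := by rw [← hr]; simp
  ext i j
  fin_cases b <;> fin_cases i <;> fin_cases j <;>
    simp [aliceFactor, krausLabel, proj, vecMulVec_apply, ketAdd, ketSub, ket, hr, hs,
      Fin.sum_univ_three, h2] <;> norm_num

theorem isInstrument_bobOp (a : Fin 3) : IsInstrument (bobOp a) := by
  refine ⟨fun b => isCP_krausOp _, isTP_sum_krausOp ?_⟩
  simp only [bobKraus_eq, conjTranspose_outer_mul_outer]
  have h2 := inv_sqrt_two_mul_self
  generalize hr : ((Real.sqrt 2 : ℝ) : ℂ)⁻¹ = r at h2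
  have hs : starRingEnd ℂ r = r := by rw [← hr]; simp
  ext i j
  fin_cases a <;> fin_cases i <;> fin_cases j <;>
    simp [bobFactor, krausLabel, proj, vecMulVec_apply, ketAdd, ketSub, ket, hr, hs,
      Fin.sum_univ_three, h2] <;> norm_num

theorem nineStateMap_apply (ρ : Matrix (Fin 3 × Fin 3) (Fin 3 × Fin 3) ℂ) :
    nineStateMap ρ = ∑ a, ∑ b, (aliceKraus a b ⊗ₖ bobKraus a b) * ρ *
      (aliceKraus a b ⊗ₖ bobKraus a b)ᴴ := by
  simp [nineStateMap, aliceOp, bobOp, tensorOp_krausOp, LinearMap.sum_apply]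

/-- The vector `|k⟩|k⟩`. -/
noncomputable def ketPair (k : Fin 9) : Fin 9 × Fin 9 → ℂ := fun q => ket k q.1 * ket k q.2

theorem ketPair_dotProduct_ketPair (j k : Fin 9) :
    ketPair j ⬝ᵥ ketPair k = if j = k then 1 else 0 := by
  simp [ketPair, ket, dotProduct, Fintype.sum_prod_type, Pi.single_apply, eq_comm]

@[simp] theorem star_ketPair (k : Fin 9) : star (ketPair k) = ketPair k := by
  ext q
  simp [ketPair, ket, Pi.single_apply, apply_ite (starRingEnd ℂ)]

theorem proj_ketPair (k : Fin 9) : proj (ketPair k) = proj (ket k) ⊗ₖ proj (ket k) := by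
  ext ⟨i, j⟩ ⟨k, l⟩
  simp only [proj, star_ketPair, star_ket, vecMulVec_apply, kronecker_apply, ketPair]
  ring

/-- The products `K_{a|b} ⊗ K_{b|a}` of the local Kraus operators are the operators
`|k⟩|k⟩⟨ψ_k|`. -/
theorem nineStateMap_eq :
    nineStateMap = ∑ k, krausOp (vecMulVec (ketPair k) (star (nineStates k))) := by
  rw [← sum_krausLabel]
  refine Finset.sum_congr rfl fun a _ => Finset.sum_congr rfl fun b _ => ?_
  rw [aliceOp, bobOp, tensorOp_krausOp, aliceKraus_eq, bobKraus_eq, nineStates_eq]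
  congr 1
  ext ⟨i, j⟩ ⟨k, l⟩
  simp only [outer, vecMulVec_apply, kronecker_apply, ketPair, prodKet, Pi.star_apply, star_mul']
  ring

/-- Nine orthonormal vectors in a nine-dimensional space resolve the identity. -/
theorem sum_proj_nineStates : ∑ k, proj (nineStates k) = 1 := by
  let U : Matrix (Fin 3 × Fin 3) (Fin 9) ℂ := Matrix.of fun q k => nineStates k q
  have hU : Uᴴ * U = 1 := by
    ext j k
    rw [Matrix.one_apply, ← nineStates_orthonormal]
    rfl
  rw [← (mul_eq_one_comm_of_card_eq _ _ _ (by simp)).1 hU]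
  ext p q
  simp [U, proj, Matrix.sum_apply, Matrix.mul_apply, vecMulVec_apply]

theorem isCPTP_nineStateMap : IsCPTP nineStateMap := by
  rw [nineStateMap_eq]
  refine ⟨IsCP.sum fun k _ => isCP_krausOp _, isTP_sum_krausOp ?_⟩
  rw [← sum_proj_nineStates]
  simp [proj, conjTranspose_vecMulVec, vecMulVec_mul_vecMulVec, ketPair_dotProduct_ketPair]

theorem nineStateMap_mem_LOCCStar : nineStateMap ∈ LOCCStar 3 3 9 9 := by
  refine ⟨isCPTP_nineStateMap, Fin 3, Fin 3, Fin 3, Fin 3, inferInstance, inferInstance,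
    inferInstance, inferInstance, fun oA oB iA iB => if iA = oB ∧ iB = oA then 1 else 0,
    aliceOp, bobOp, ⟨fun oA oB iA iB => by dsimp only; split_ifs <;> norm_num,
      fun oA oB => by simp [ite_and]⟩, isInstrument_aliceOp, isInstrument_bobOp, ?_⟩
  simp only [apply_ite Complex.ofReal, Complex.ofReal_one, Complex.ofReal_zero, ite_smul,
    one_smul, zero_smul, ite_and, Finset.sum_ite_eq, Finset.mem_univ, if_true]
  rw [nineStateMap, Finset.sum_comm]

theorem nineStateMap_proj_nineStates (k : Fin 9) :
    nineStateMap (proj (nineStates k)) = proj (ket k) ⊗ₖ proj (ket k) := by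
  rw [nineStateMap_eq, LinearMap.sum_apply, ← proj_ketPair, Finset.sum_eq_single k]
  · simp [proj, conjTranspose_vecMulVec, vecMulVec_mul_vecMulVec, nineStates_orthonormal]
  · intro j _ hj
    simp [proj, conjTranspose_vecMulVec, vecMulVec_mul_vecMulVec, nineStates_orthonormal, hj]
  · simp

theorem trace_nineStateMap_proj (k x y : Fin 9) :
    ((proj (ket x) ⊗ₖ proj (ket y)) * nineStateMap (proj (nineStates k))).trace =
      if x = k ∧ y = k then 1 else 0 := by
  have h : ∀ z : Fin 9, (proj (ket z) * proj (ket k)).trace = if z = k then 1 else 0 := by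
    intro z
    by_cases hz : z = k <;>
      simp [proj, vecMulVec_mul_vecMulVec, ket_dotProduct_ket, trace_vecMulVec, hz]
  rw [nineStateMap_proj_nineStates, ← mul_kronecker_mul, trace_kronecker, h, h]
  by_cases hx : x = k <;> simp [hx]

theorem isPOVM_ket {d : ℕ} : IsPOVM fun k : Fin d => proj (ket k) := by
  refine ⟨fun k => posSemidef_vecMulVec_self_star _, ?_⟩
  ext i j
  simp [proj, Matrix.sum_apply, vecMulVec_apply, ket, Pi.single_apply, Matrix.one_apply]

theorem locallyDiscriminates_nineStateMap : LocallyDiscriminates nineStateMap nineStates := by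
  refine ⟨Fin 9, Fin 9, inferInstance, inferInstance, fun x => proj (ket x),
    fun y => proj (ket y), fun x _ => x, isPOVM_ket, isPOVM_ket, fun k => ?_⟩
  simp only [trace_nineStateMap_proj]
  simp [ite_and]

/-! ### Local effects compatible with the nine states -/

/-- A linear functional on operators that is a multiple of the trace, i.e. whose effect operator is
a multiple of the identity. -/
def IsTraceMultiple {m : Type} [Fintype m] (f : Matrix m m ℂ →ₗ[ℂ] ℂ) : Prop :=
  ∃ c, ∀ X, f X = c * X.trace

theorem map_vecMulVec_star {m : Type} [Fintype m] [DecidableEq m] (f : Matrix m m ℂ →ₗ[ℂ] ℂ)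
    (u w : m → ℂ) :
    f (vecMulVec u (star w)) = ∑ i, ∑ j, u i * star (w j) * f (Matrix.single i j 1) := by
  conv_lhs => rw [matrix_eq_sum_single (vecMulVec u (star w))]
  simp only [map_sum]
  refine Finset.sum_congr rfl fun i _ => Finset.sum_congr rfl fun j _ => ?_
  rw [← smul_eq_mul (a := u i * star (w j)), ← map_smul, smul_single]
  simp [vecMulVec_apply]

/-- A functional on `3 × 3` matrices with vanishing off-diagonal and equal diagonal coefficients is
a multiple of the trace. -/
theorem isTraceMultiple_of_coeff {f : Matrix (Fin 3) (Fin 3) ℂ →ₗ[ℂ] ℂ}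
    (h : ∀ i j, i ≠ j → f (Matrix.single i j 1) = 0)
    (h₁ : f (Matrix.single 0 0 1) = f (Matrix.single 1 1 1))
    (h₂ : f (Matrix.single 1 1 1) = f (Matrix.single 2 2 1)) : IsTraceMultiple f := by
  refine ⟨f (Matrix.single 0 0 1), fun X => ?_⟩
  suffices f = f (Matrix.single 0 0 1) • Matrix.traceLinearMap (Fin 3) ℂ ℂ by
    conv_lhs => rw [this]
    simp
  refine Matrix.ext_linearMap _ fun i j => LinearMap.ext_ring ?_
  by_cases hij : i = j
  · subst hij
    fin_cases i <;> simp [h₁, h₂]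
  · simp [h i j hij, hij]

/-- An effect on Alice's side alone that keeps the nine states orthogonal is trivial: the pairs with
`|1⟩|1⟩` and the pair `|0⟩|0 + 1⟩`, `|2⟩|1 + 2⟩` annihilate its off-diagonal entries, and the pairs
`|0 ± 1⟩|2⟩` and `|1 ± 2⟩|0⟩` equate its diagonal entries. -/
theorem isTraceMultiple_alice {f : Matrix (Fin 3) (Fin 3) ℂ →ₗ[ℂ] ℂ}
    (h : ∀ j l, j ≠ l → f (vecMulVec (aliceFactor j) (star (aliceFactor l))) *
      (star (bobFactor l) ⬝ᵥ bobFactor j) = 0) : IsTraceMultiple f := by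
  simp only [map_vecMulVec_star] at h
  have h2 := inv_sqrt_two_mul_self
  generalize hr : ((Real.sqrt 2 : ℝ) : ℂ)⁻¹ = r at h2
  have hs : starRingEnd ℂ r = r := by rw [← hr]; simp
  have hr0 : r ≠ 0 := by rintro rfl; norm_num at h2
  have h01 := h 0 8 (by decide)
  have h10 := h 8 0 (by decide)
  have h21 := h 4 8 (by decide)
  have h12 := h 8 4 (by decide)
  have h02 := h 0 4 (by decide)
  have h20 := h 4 0 (by decide)
  have hd := h 2 3 (by decide)
  have hd' := h 6 7 (by decide)
  simp [aliceFactor, bobFactor, ketAdd, ketSub, ket, hr, hs, hr0, dotProduct, Fin.sum_univ_three]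
    at h01 h10 h21 h12 h02 h20 hd hd'
  refine isTraceMultiple_of_coeff (fun i j hij => ?_) ?_ ?_
  · fin_cases i <;> fin_cases j <;> simp_all
  · simp only [h01, h10, h2] at hd
    linear_combination 2 * hd
  · simp only [h12, h21, h2] at hd'
    linear_combination 2 * hd'

/-- The analogue of `isTraceMultiple_alice` for effects on Bob's side. -/
theorem isTraceMultiple_bob {f : Matrix (Fin 3) (Fin 3) ℂ →ₗ[ℂ] ℂ}
    (h : ∀ j l, j ≠ l → (star (aliceFactor l) ⬝ᵥ aliceFactor j) *
      f (vecMulVec (bobFactor j) (star (bobFactor l))) = 0) : IsTraceMultiple f := by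
  simp only [map_vecMulVec_star] at h
  have h2 := inv_sqrt_two_mul_self
  generalize hr : ((Real.sqrt 2 : ℝ) : ℂ)⁻¹ = r at h2
  have hs : starRingEnd ℂ r = r := by rw [← hr]; simp
  have hr0 : r ≠ 0 := by rintro rfl; norm_num at h2
  have h01 := h 6 8 (by decide)
  have h10 := h 8 6 (by decide)
  have h21 := h 2 8 (by decide)
  have h12 := h 8 2 (by decide)
  have h02 := h 6 2 (by decide)
  have h20 := h 2 6 (by decide)
  have hd := h 0 1 (by decide)
  have hd' := h 4 5 (by decide)
  simp [aliceFactor, bobFactor, ketAdd, ketSub, ket, hr, hs, hr0, dotProduct, Fin.sum_univ_three]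
    at h01 h10 h21 h12 h02 h20 hd hd'
  refine isTraceMultiple_of_coeff (fun i j hij => ?_) ?_ ?_
  · fin_cases i <;> fin_cases j <;> simp_all
  · simp only [h01, h10, h2] at hd
    linear_combination 2 * hd
  · simp only [h12, h21, h2] at hd'
    linear_combination 2 * hd'

/-! ### Positive functionals -/

/-- A linear functional that is nonnegative on positive semidefinite operators. -/
def IsPositive {m : Type} [Fintype m] (f : Matrix m m ℂ →ₗ[ℂ] ℂ) : Prop :=
  ∀ X : Matrix m m ℂ, X.PosSemidef → 0 ≤ f X

theorem posSemidef_proj {m : Type} [Finite m] (v : m → ℂ) : (proj v).PosSemidef :=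
  posSemidef_vecMulVec_self_star v

theorem IsPositive.comp {m m' : Type} [Fintype m] [Fintype m'] [DecidableEq m] [DecidableEq m']
    {f : Matrix m' m' ℂ →ₗ[ℂ] ℂ} (hf : IsPositive f) {Φ : SuperOp m m'} (hΦ : IsCP Φ) :
    IsPositive (f ∘ₗ Φ) := fun _ hX => hf _ (hΦ.posSemidef hX)

theorem IsPositive.sum {m ι : Type} [Fintype m] {s : Finset ι} {f : ι → Matrix m m ℂ →ₗ[ℂ] ℂ}
    (hf : ∀ i ∈ s, IsPositive (f i)) : IsPositive (∑ i ∈ s, f i) := fun _ hX => by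
  rw [LinearMap.sum_apply]
  exact Finset.sum_nonneg fun i hi => hf i hi _ hX

theorem isPositive_zero {m : Type} [Fintype m] : IsPositive (0 : Matrix m m ℂ →ₗ[ℂ] ℂ) :=
  fun _ _ => le_rfl

theorem _root_.Matrix.PosSemidef.trace_mul_nonneg {m : Type} [Fintype m] [DecidableEq m]
    {A X : Matrix m m ℂ} (hA : A.PosSemidef) (hX : X.PosSemidef) : 0 ≤ (A * X).trace := by
  obtain ⟨B, rfl⟩ := hA.exists_conjTranspose_mul_self
  rw [Matrix.mul_assoc, Matrix.trace_mul_comm]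
  exact (hX.mul_mul_conjTranspose_same B).trace_nonneg

/-- In the order of `ℂ`, nonnegativity includes being real. -/
theorem eq_zero_of_forall_real_nonneg {x y : ℂ} (h : ∀ s : ℝ, 0 ≤ (s : ℂ) * x + y) : x = 0 := by
  have hre : ∀ s : ℝ, 0 ≤ s * x.re + y.re := fun s => by simpa using (Complex.le_def.1 (h s)).1
  have him : ∀ s : ℝ, 0 = s * x.im + y.im := fun s => by simpa using (Complex.le_def.1 (h s)).2
  apply Complex.ext
  · by_contra hx
    replace hx : x.re ≠ 0 := hx
    have := hre (-(y.re + 1) / x.re)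
    rw [div_mul_cancel₀ _ hx] at this
    linarith
  · have h₀ := him 0
    have h₁ := him 1
    simp only [Complex.zero_im]
    linarith

/-- The Cauchy–Schwarz inequality for the semi-inner product `(v, w) ↦ f |v⟩⟨w|`, in the degenerate
case: a positive functional vanishing on `|v⟩⟨v|` vanishes on all `|v⟩⟨w|` and `|w⟩⟨v|`. -/
theorem IsPositive.cross_eq_zero {m : Type} [Fintype m] {f : Matrix m m ℂ →ₗ[ℂ] ℂ}
    (hf : IsPositive f) {v : m → ℂ} (hv : f (proj v) = 0) (w : m → ℂ) :
    f (vecMulVec v (star w)) = 0 ∧ f (vecMulVec w (star v)) = 0 := by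
  have key : ∀ t : ℂ, 0 ≤ t * f (vecMulVec v (star w)) + star t * f (vecMulVec w (star v)) +
      f (proj w) := fun t => by
    have h := hf _ (posSemidef_proj (t • v + w))
    have e : proj (t • v + w) = (t * star t) • proj v + t • vecMulVec v (star w) +
        star t • vecMulVec w (star v) + proj w := by
      ext i j
      simp [proj, vecMulVec_apply]
      ring
    rw [e] at h
    simpa only [map_add, map_smul, hv, smul_eq_mul, mul_zero, zero_add] using h
  have h₁ : f (vecMulVec v (star w)) + f (vecMulVec w (star v)) = 0 :=
    eq_zero_of_forall_real_nonneg (y := f (proj w)) fun s => by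
      have := key s
      simp only [Complex.star_def, Complex.conj_ofReal] at this
      rwa [mul_add]
  have h₂ : Complex.I * (f (vecMulVec v (star w)) - f (vecMulVec w (star v))) = 0 :=
    eq_zero_of_forall_real_nonneg (y := f (proj w)) fun s => by
      have := key (s * Complex.I)
      simp only [Complex.star_def, map_mul, Complex.conj_ofReal, Complex.conj_I] at this
      convert this using 1
      ring
  have h₃ := (mul_eq_zero.1 h₂).resolve_left Complex.I_ne_zero
  constructor
  · linear_combination (h₁ + h₃) / 2
  · linear_combination (h₁ - h₃) / 2

/-- A family of positive functionals that identifies the vectors `ψ j` adds up to a functional for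
which they are orthogonal. -/
theorem sum_cross_eq_zero {m : Type} [Fintype m] {n : ℕ} {P : Fin n → Matrix m m ℂ →ₗ[ℂ] ℂ}
    (hP : ∀ k, IsPositive (P k)) {ψ : Fin n → m → ℂ}
    (h : ∀ j k, j ≠ k → P k (proj (ψ j)) = 0) {j l : Fin n} (hjl : j ≠ l) :
    ∑ k, P k (vecMulVec (ψ j) (star (ψ l))) = 0 := by
  refine Finset.sum_eq_zero fun k _ => ?_
  by_cases hk : j = k
  · exact ((hP k).cross_eq_zero (h l k fun e => hjl (hk.trans e.symm)) _).2
  · exact ((hP k).cross_eq_zero (h j k hk) _).1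

/-! ### Protocols that discriminate the nine states -/

/-- If Bob's functionals add up to a nonzero multiple of the trace, and Alice's functional `f`
combined with each of them keeps the nine states orthogonal, then summing over Bob's outcomes shows
that `f` is a multiple of the trace. If `f` is nonzero, the same then holds for each of Bob's
functionals. -/
theorem isTraceMultiple_pair {Y : Type} [Fintype Y] {f : Matrix (Fin 3) (Fin 3) ℂ →ₗ[ℂ] ℂ}
    {h : Y → Matrix (Fin 3) (Fin 3) ℂ →ₗ[ℂ] ℂ} {β : ℂ} (hβ : β ≠ 0)
    (hsum : ∀ X, ∑ y, h y X = β * X.trace)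
    (H : ∀ y j l, j ≠ l → f (vecMulVec (aliceFactor j) (star (aliceFactor l))) *
      h y (vecMulVec (bobFactor j) (star (bobFactor l))) = 0) :
    ∃ α, (∀ X, f X = α * X.trace) ∧ (α = 0 ∨ ∀ y, IsTraceMultiple (h y)) := by
  obtain ⟨α, hα⟩ : IsTraceMultiple f := by
    refine isTraceMultiple_alice fun j l hjl => ?_
    have h0 := Finset.sum_eq_zero fun y (_ : y ∈ Finset.univ) => H y j l hjl
    rw [← Finset.mul_sum, hsum, trace_vecMulVec, dotProduct_comm] at h0
    refine (mul_eq_zero.1 ?_).resolve_left hβ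
    linear_combination h0
  refine ⟨α, hα, or_iff_not_imp_left.2 fun h0 y => isTraceMultiple_bob fun j l hjl => ?_⟩
  have h1 := H y j l hjl
  rw [hα, trace_vecMulVec, dotProduct_comm] at h1
  refine (mul_eq_zero.1 ?_).resolve_left h0
  linear_combination h1

variable {a' b' c : ℕ}

/-- The functionals `G x k` give the probabilities of the guesses `k` of some continuation of a
protocol with branches `Φ x`, and that continuation identifies the nine states. -/
structure IsDiscriminator (Φ : Fin c → SuperOp (Fin 3 × Fin 3) (Fin a' × Fin b'))
    (G : Fin c → Fin 9 → Matrix (Fin a' × Fin b') (Fin a' × Fin b') ℂ →ₗ[ℂ] ℂ) : Prop where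
  isPositive : ∀ x k, IsPositive (G x k)
  sum_eq_trace : ∀ x Z, ∑ k, G x k Z = Z.trace
  eq_zero : ∀ j k, j ≠ k → ∑ x, G x k (Φ x (proj (nineStates j))) = 0

/-- The trace after a linear map, as a functional of the input. -/
noncomputable def traceAfter {m m' : Type} [Fintype m'] (Φ : SuperOp m m') :
    Matrix m m ℂ →ₗ[ℂ] ℂ :=
  Matrix.traceLinearMap m' ℂ ℂ ∘ₗ Φ

@[simp] theorem traceAfter_apply {m m' : Type} [Fintype m'] (Φ : SuperOp m m')
    (X : Matrix m m ℂ) : traceAfter Φ X = (Φ X).trace := rfl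

/-- A product of local operations that is zero, or has local effects proportional to the identity:
it reveals nothing about the state. -/
def IsTrivialPair (𝓐 : SuperOp (Fin 3) (Fin a')) (𝓑 : SuperOp (Fin 3) (Fin b')) : Prop :=
  𝓐 = 0 ∨ 𝓑 = 0 ∨ (IsTraceMultiple (traceAfter 𝓐) ∧ IsTraceMultiple (traceAfter 𝓑))

theorem IsCP.trace_coeff_ne_zero {m' : Type} [Fintype m'] [DecidableEq m']
    {Φ : SuperOp (Fin 3) m'} (hΦ : IsCP Φ) (h0 : Φ ≠ 0) {α : ℂ}
    (h : ∀ X, traceAfter Φ X = α * X.trace) : α ≠ 0 := by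
  rintro rfl
  exact h0 (hΦ.eq_zero_of_trace_eq_zero (by simpa using h 1))

/-- Each outcome of a discriminating protocol, being positive, separately respects the nine
states. -/
theorem IsDiscriminator.term_eq_zero {ι : Type} [Fintype ι]
    {Φ : Fin c → SuperOp (Fin 3 × Fin 3) (Fin a' × Fin b')}
    {G : Fin c → Fin 9 → Matrix (Fin a' × Fin b') (Fin a' × Fin b') ℂ →ₗ[ℂ] ℂ}
    (hG : IsDiscriminator Φ G) {Θ : Fin c → ι → SuperOp (Fin 3 × Fin 3) (Fin a' × Fin b')}
    (hΘ : ∀ x i, IsCP (Θ x i)) (hΦ : ∀ x, Φ x = ∑ i, Θ x i) (x : Fin c) (i : ι) {j k : Fin 9}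
    (hjk : j ≠ k) : G x k (Θ x i (proj (nineStates j))) = 0 := by
  have hpos : ∀ x i, 0 ≤ G x k (Θ x i (proj (nineStates j))) := fun x i =>
    hG.isPositive x k _ ((hΘ x i).posSemidef (posSemidef_proj _))
  have h := hG.eq_zero j k hjk
  simp only [hΦ, LinearMap.sum_apply, map_sum] at h
  rw [Finset.sum_eq_zero_iff_of_nonneg fun x _ => Finset.sum_nonneg fun i _ => hpos x i] at h
  exact (Finset.sum_eq_zero_iff_of_nonneg fun i _ => hpos x i).1 (h x (Finset.mem_univ x)) i
    (Finset.mem_univ i)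

theorem vecMulVec_nineStates (j l : Fin 9) :
    vecMulVec (nineStates j) (star (nineStates l)) =
      vecMulVec (aliceFactor j) (star (aliceFactor l)) ⊗ₖ
        vecMulVec (bobFactor j) (star (bobFactor l)) := by
  rw [nineStates_eq, nineStates_eq, vecMulVec_prodKet]

/-- In a protocol that can be completed to one identifying the nine states, nobody ever learns
anything: every branch is a sum of trivial product operations. -/
theorem LOCCBranches.exists_trivial_terms
    {Φ : Fin c → SuperOp (Fin 3 × Fin 3) (Fin a' × Fin b')} (h : LOCCBranches 3 3 a' b' c Φ)
    {G : Fin c → Fin 9 → Matrix (Fin a' × Fin b') (Fin a' × Fin b') ℂ →ₗ[ℂ] ℂ}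
    (hG : IsDiscriminator Φ G) :
    ∃ (ι : Type) (_ : Fintype ι) (𝓐 : Fin c → ι → SuperOp (Fin 3) (Fin a'))
      (𝓑 : Fin c → ι → SuperOp (Fin 3) (Fin b')),
      (∀ x i, IsCP (𝓐 x i)) ∧ (∀ x i, IsCP (𝓑 x i)) ∧ (∀ x i, IsTrivialPair (𝓐 x i) (𝓑 x i)) ∧
      ∀ x, Φ x = ∑ i, tensorOp (𝓐 x i) (𝓑 x i) := by
  induction h with
  | init =>
    have hid : IsTraceMultiple (traceAfter (LinearMap.id : SuperOp (Fin 3) (Fin 3))) :=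
      ⟨1, fun X => by simp⟩
    exact ⟨Unit, inferInstance, fun _ _ => LinearMap.id, fun _ _ => LinearMap.id,
      fun _ _ => isCP_id, fun _ _ => isCP_id, fun _ _ => Or.inr (Or.inr ⟨hid, hid⟩),
      fun _ => by simp⟩
  | @round a₁ b₁ c₁ a₂ b₂ c₂ d Φ _ 𝓐r h𝓐r 𝓑r h𝓑r ih =>
    -- The new round followed by the given continuation is a continuation of the earlier rounds.
    have hG' : IsDiscriminator Φ fun x k => ∑ o, ∑ o', G o' k ∘ₗ tensorOp (𝓐r x o) (𝓑r o o') := by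
      refine ⟨fun x k => ?_, fun x Z => ?_, fun j k hjk => ?_⟩
      · exact IsPositive.sum fun o _ => IsPositive.sum fun o' _ =>
          (hG.isPositive o' k).comp (((h𝓐r x).1 o).tensorOp ((h𝓑r o).1 o'))
      · simp only [LinearMap.sum_apply, LinearMap.comp_apply]
        rw [← sum_trace_tensorOp (h𝓐r x) h𝓑r Z, Finset.sum_comm]
        refine Finset.sum_congr rfl fun o _ => ?_
        rw [Finset.sum_comm]
        exact Finset.sum_congr rfl fun o' _ => hG.sum_eq_trace o' _
      · rw [← hG.eq_zero j k hjk]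
        simp only [LinearMap.sum_apply, LinearMap.comp_apply, map_sum]
        rw [Finset.sum_comm]
        trans ∑ o, ∑ o', ∑ x, G o' k (tensorOp (𝓐r x o) (𝓑r o o') (Φ x (proj (nineStates j))))
        · exact Finset.sum_congr rfl fun o _ => Finset.sum_comm
        · rw [Finset.sum_comm]
          exact Finset.sum_congr rfl fun o' _ => Finset.sum_comm
    obtain ⟨ι, _, 𝓐, 𝓑, h𝓐, h𝓑, htriv, hΦ⟩ := ih hG'
    have hA : ∀ x o i, IsCP (𝓐r x o ∘ₗ 𝓐 x i) := fun x o i => ((h𝓐r x).1 o).comp (h𝓐 x i)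
    have hB : ∀ x o o' i, IsCP (𝓑r o o' ∘ₗ 𝓑 x i) := fun x o o' i =>
      ((h𝓑r o).1 o').comp (h𝓑 x i)
    have hΦ' : ∀ o', ∑ x, ∑ o, tensorOp (𝓐r x o) (𝓑r o o') ∘ₗ Φ x =
        ∑ q : Fin c₁ × Fin d × ι,
          tensorOp (𝓐r q.1 q.2.1 ∘ₗ 𝓐 q.1 q.2.2) (𝓑r q.2.1 o' ∘ₗ 𝓑 q.1 q.2.2) := fun o' => by
      ext1 Z
      simp only [Fintype.sum_prod_type, hΦ, tensorOp_comp, LinearMap.sum_apply,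
        LinearMap.comp_apply, map_sum]
    refine ⟨Fin c₁ × Fin d × ι, inferInstance, fun _ q => 𝓐r q.1 q.2.1 ∘ₗ 𝓐 q.1 q.2.2,
      fun o' q => 𝓑r q.2.1 o' ∘ₗ 𝓑 q.1 q.2.2, fun _ q => hA _ _ _, fun o' q => hB _ _ _ _,
      fun o' q => ?_, hΦ'⟩
    obtain ⟨x, o, i⟩ := q
    rcases htriv x i with h0 | h0 | ⟨-, β, hβ⟩
    · exact Or.inl (by simp [h0])
    · exact Or.inr (Or.inl (by simp [h0]))
    by_cases h0 : 𝓑 x i = 0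
    · exact Or.inr (Or.inl (by simp [h0]))
    obtain ⟨α, hα, hα'⟩ := isTraceMultiple_pair (f := traceAfter (𝓐r x o ∘ₗ 𝓐 x i))
      (h := fun o' => traceAfter (𝓑r o o' ∘ₗ 𝓑 x i)) ((h𝓑 x i).trace_coeff_ne_zero h0 hβ)
      (fun X => by simpa using ((h𝓑r o).sum_trace (𝓑 x i X)).trans (hβ X))
      (fun o' j l hjl => by
        have hcp : IsCP (tensorOp (𝓐r x o ∘ₗ 𝓐 x i) (𝓑r o o' ∘ₗ 𝓑 x i)) :=
          (hA x o i).tensorOp (hB x o o' i)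
        have h := sum_cross_eq_zero
          (P := fun k => G o' k ∘ₗ tensorOp (𝓐r x o ∘ₗ 𝓐 x i) (𝓑r o o' ∘ₗ 𝓑 x i))
          (fun k => (hG.isPositive o' k).comp hcp) (ψ := nineStates)
          (fun j k hjk => hG.term_eq_zero (ι := Fin c₁ × Fin d × ι)
            (fun o' q => (hA q.1 q.2.1 q.2.2).tensorOp (hB q.1 q.2.1 o' q.2.2)) hΦ' o' (x, o, i)
            hjk) hjl
        simp only [LinearMap.comp_apply (f := G o' _)] at h
        rwa [hG.sum_eq_trace, vecMulVec_nineStates, tensorOp_kronecker, trace_kronecker] at h)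
    rcases hα' with rfl | hα'
    · exact Or.inl ((hA x o i).eq_zero_of_trace_eq_zero (by simpa using hα 1))
    · exact Or.inr (Or.inr ⟨⟨α, hα⟩, hα' o'⟩)

theorem trace_proj_nineStates (j : Fin 9) : (proj (nineStates j)).trace = 1 := by
  rw [proj, trace_vecMulVec, dotProduct_comm, nineStates_orthonormal, if_pos rfl]

/-- The functional `Z ↦ tr (A Z)`. -/
noncomputable def traceMul {m : Type} [Fintype m] (A : Matrix m m ℂ) : Matrix m m ℂ →ₗ[ℂ] ℂ :=
  Matrix.traceLinearMap m ℂ ℂ ∘ₗ LinearMap.mulLeft ℂ A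

@[simp] theorem traceMul_apply {m : Type} [Fintype m] (A Z : Matrix m m ℂ) :
    traceMul A Z = (A * Z).trace := rfl

theorem IsPOVM.sum_trace_mul {m X : Type} [Fintype m] [DecidableEq m] [Fintype X]
    {E : X → Matrix m m ℂ} (hE : IsPOVM E) (Z : Matrix m m ℂ) :
    ∑ x, (E x * Z).trace = Z.trace := by
  rw [← Matrix.trace_sum, ← Matrix.sum_mul, hE.2, Matrix.one_mul]

/-- All branches, and the final measurement, consist of trivial operations. A guess `k` that occurs
with positive probability would then occur for every input state, while perfect discrimination
excludes it for all but one of them. So no outcome has positive probability, which contradicts trace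
preservation. -/
theorem not_locallyDiscriminates_of_mem_LOCC
    {M : SuperOp (Fin 3 × Fin 3) (Fin a' × Fin b')} (hM : M ∈ LOCC 3 3 a' b') :
    ¬ LocallyDiscriminates M nineStates := by
  rintro ⟨X, Y, _, _, E, F, g, hE, hF, hg⟩
  obtain ⟨c, Φ, hΦ, rfl⟩ := hM
  have hEF : ∀ Z, ∑ x, ∑ y, ((E x ⊗ₖ F y) * Z).trace = Z.trace := fun Z => by
    simp only [← Matrix.trace_sum, ← Matrix.sum_mul]
    simp only [← kronecker_sum_right, ← kronecker_sum_left, hE.2, hF.2, one_kronecker_one,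
      Matrix.one_mul]
  have hpos : ∀ x y, IsPositive (traceMul (E x ⊗ₖ F y)) := fun x y Z hZ =>
    ((hE.1 x).kronecker (hF.1 y)).trace_mul_nonneg hZ
  let G : Fin 9 → Matrix (Fin a' × Fin b') (Fin a' × Fin b') ℂ →ₗ[ℂ] ℂ := fun k =>
    ∑ x, ∑ y, if g x y = k then traceMul (E x ⊗ₖ F y) else 0
  have hGpos : ∀ k, IsPositive (G k) := fun k => IsPositive.sum fun x _ => IsPositive.sum
    fun y _ => by
      split_ifs
      exacts [hpos x y, isPositive_zero]
  have hGsum : ∀ Z, ∑ k, G k Z = Z.trace := fun Z => by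
    rw [← hEF]
    simp only [G, LinearMap.sum_apply]
    rw [Finset.sum_comm]
    refine Finset.sum_congr rfl fun x _ => ?_
    rw [Finset.sum_comm]
    refine Finset.sum_congr rfl fun y _ => ?_
    simp [apply_ite (fun f : Matrix (Fin a' × Fin b') (Fin a' × Fin b') ℂ →ₗ[ℂ] ℂ => f Z)]
  have hMtr : ∀ j, ((∑ x, Φ x) (proj (nineStates j))).trace = 1 := fun j => by
    rw [LinearMap.sum_apply, Matrix.trace_sum, hΦ.sum_trace, trace_proj_nineStates]
  have hMcp : IsCP (∑ x, Φ x) := IsCP.sum fun x _ => hΦ.isCP x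
  have hG : IsDiscriminator Φ fun _ => G := by
    refine ⟨fun _ => hGpos, fun _ => hGsum, fun j k hjk => ?_⟩
    rw [← map_sum, ← LinearMap.sum_apply]
    have h1 : G j ((∑ x, Φ x) (proj (nineStates j))) = 1 := by
      rw [← hg j]
      simp only [G, LinearMap.sum_apply]
      refine Finset.sum_congr rfl fun x _ => Finset.sum_congr rfl fun y _ => ?_
      split_ifs <;> rfl
    have hs := hGsum ((∑ x, Φ x) (proj (nineStates j)))
    rw [hMtr, ← Finset.add_sum_erase _ _ (Finset.mem_univ j), h1, add_eq_left,
      Finset.sum_eq_zero_iff_of_nonneg fun k _ =>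
        hGpos k _ (hMcp.posSemidef (posSemidef_proj _))] at hs
    exact hs k (by simp [hjk.symm])
  obtain ⟨ι, _, 𝓐, 𝓑, h𝓐, h𝓑, htriv, hrep⟩ := hΦ.exists_trivial_terms hG
  suffices hzero : ∀ x i, tensorOp (𝓐 x i) (𝓑 x i) = 0 by
    have h := hMtr 0
    simp [hrep, hzero] at h
  intro z i
  rcases htriv z i with h0 | h0 | ⟨⟨α, hα⟩, β, hβ⟩
  · simp [h0]
  · simp [h0]
  by_cases hA0 : 𝓐 z i = 0
  · simp [hA0]
  by_cases hB0 : 𝓑 z i = 0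
  · simp [hB0]
  have hα0 := (h𝓐 z i).trace_coeff_ne_zero hA0 hα
  have hβ0 := (h𝓑 z i).trace_coeff_ne_zero hB0 hβ
  have hcp := (h𝓐 z i).tensorOp (h𝓑 z i)
  -- A pair of outcomes with guess `k` excludes every state but the one numbered `k`.
  have hexcl : ∀ x y j, j ≠ g x y →
      traceMul (E x ⊗ₖ F y) (tensorOp (𝓐 z i) (𝓑 z i) (proj (nineStates j))) = 0 := by
    intro x y j hj
    have h := hG.term_eq_zero (fun x i => (h𝓐 x i).tensorOp (h𝓑 x i)) hrep z i hj
    simp only [G, LinearMap.sum_apply] at h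
    have hnn : ∀ x' y', 0 ≤ (if g x' y' = g x y then traceMul (E x' ⊗ₖ F y') else 0)
        (tensorOp (𝓐 z i) (𝓑 z i) (proj (nineStates j))) := fun x' y' => by
      split_ifs
      exacts [hpos x' y' _ (hcp.posSemidef (posSemidef_proj _)), le_rfl]
    rw [Finset.sum_eq_zero_iff_of_nonneg fun x' _ => Finset.sum_nonneg fun y' _ => hnn x' y'] at h
    simpa using (Finset.sum_eq_zero_iff_of_nonneg fun y' _ => hnn x y').1
      (h x (Finset.mem_univ x)) y (Finset.mem_univ y)
  have hterm : ∀ x y j l, traceMul (E x ⊗ₖ F y)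
      (tensorOp (𝓐 z i) (𝓑 z i) (vecMulVec (nineStates j) (star (nineStates l)))) =
      traceMul (E x) (𝓐 z i (vecMulVec (aliceFactor j) (star (aliceFactor l)))) *
        traceMul (F y) (𝓑 z i (vecMulVec (bobFactor j) (star (bobFactor l)))) := by
    intro x y j l
    rw [vecMulVec_nineStates, tensorOp_kronecker, traceMul_apply, ← mul_kronecker_mul,
      trace_kronecker, traceMul_apply, traceMul_apply]
  -- Hence the final measurement is as uninformative as the rounds before it.
  have hmul : ∀ x, ∃ φ, (∀ Z, traceMul (E x) (𝓐 z i Z) = φ * Z.trace) ∧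
      (φ = 0 ∨ ∀ y, IsTraceMultiple (traceMul (F y) ∘ₗ 𝓑 z i)) := fun x =>
    isTraceMultiple_pair (f := traceMul (E x) ∘ₗ 𝓐 z i) (h := fun y => traceMul (F y) ∘ₗ 𝓑 z i) hβ0
      (fun Z => by simpa [hF.sum_trace_mul] using hβ Z) (fun y j l hjl => by
        rw [LinearMap.comp_apply, LinearMap.comp_apply, ← hterm]
        by_cases hj : j = g x y
        · exact (((hpos x y).comp hcp).cross_eq_zero
            (hexcl x y l fun e => hjl (hj.trans e.symm)) _).2
        · exact (((hpos x y).comp hcp).cross_eq_zero (hexcl x y j hj) _).1)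
  have hprod : ∀ x y, traceMul (E x) (𝓐 z i 1) * traceMul (F y) (𝓑 z i 1) = 0 := by
    intro x y
    obtain ⟨φ, hφ, rfl | hη⟩ := hmul x
    · simp [hφ]
    obtain ⟨η, hη⟩ := hη y
    simp only [LinearMap.comp_apply] at hη
    obtain ⟨j, hj⟩ := exists_ne (g x y)
    have h := hexcl x y j hj
    rw [proj, hterm, hφ, hη] at h
    have htr : (vecMulVec (aliceFactor j) (star (aliceFactor j))).trace *
        (vecMulVec (bobFactor j) (star (bobFactor j))).trace = 1 := by
      rw [← trace_kronecker, ← vecMulVec_nineStates]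
      exact trace_proj_nineStates j
    rw [hφ, hη]
    linear_combination (trace (1 : Matrix (Fin 3) (Fin 3) ℂ) *
      trace (1 : Matrix (Fin 3) (Fin 3) ℂ)) * (h - φ * η * htr)
  have htot : (𝓐 z i 1).trace * (𝓑 z i 1).trace = 0 := by
    rw [← hE.sum_trace_mul, ← hF.sum_trace_mul, Finset.sum_mul_sum]
    exact Finset.sum_eq_zero fun x _ => Finset.sum_eq_zero fun y _ => hprod x y
  have hA1 := hα 1
  have hB1 := hβ 1
  simp only [traceAfter_apply] at hA1 hB1
  rw [hA1, hB1] at htot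
  simp [hα0, hβ0] at htot

end NineState

open NineState in
theorem mainTheorem5 :
    -- the nine product states are orthonormal
    (∀ j k : Fin 9, star (nineStates j) ⬝ᵥ nineStates k = if j = k then 1 else 0) ∧
    -- Alice's and Bob's local operations are quantum instruments for every classical input
    (∀ b : Fin 3, IsInstrument (aliceOp b)) ∧
    (∀ a : Fin 3, IsInstrument (bobOp a)) ∧
    -- the looped operation has the Kraus operators `K_{a|b} ⊗ K_{b|a}`
    (∀ ρ : Matrix (Fin 3 × Fin 3) (Fin 3 × Fin 3) ℂ,
      nineStateMap ρ = ∑ a, ∑ b, (aliceKraus a b ⊗ₖ bobKraus a b) * ρ *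
        (aliceKraus a b ⊗ₖ bobKraus a b).conjTranspose) ∧
    -- it is a CPTP map in LOCC*
    nineStateMap ∈ LOCCStar 3 3 9 9 ∧
    -- it maps `|ψ_k⟩⟨ψ_k|` to `|k⟩⟨k| ⊗ |k⟩⟨k|`
    (∀ k : Fin 9, nineStateMap (proj (nineStates k)) = proj (ket k) ⊗ₖ proj (ket k)) ∧
    -- so both parties find `k` with certainty by measuring in the computational basis
    (∀ k x y : Fin 9, ((proj (ket x) ⊗ₖ proj (ket y)) *
      nineStateMap (proj (nineStates k))).trace = if x = k ∧ y = k then 1 else 0) ∧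
    LocallyDiscriminates nineStateMap nineStates ∧
    -- no LOCC map followed by local measurements discriminates the nine states
    (∀ (a' b' : ℕ) (M : SuperOp (Fin 3 × Fin 3) (Fin a' × Fin b')), M ∈ LOCC 3 3 a' b' →
      ¬ LocallyDiscriminates M nineStates) ∧
    -- LOCC is contained in LOCC*, and the inclusion is strict
    (∀ a b a' b' : ℕ, LOCC a b a' b' ⊆ LOCCStar a b a' b') ∧
    nineStateMap ∉ LOCC 3 3 9 9 ∧
    LOCC 3 3 9 9 ⊂ LOCCStar 3 3 9 9 := by
  have hnot : ∀ (a' b' : ℕ) (M : SuperOp (Fin 3 × Fin 3) (Fin a' × Fin b')), M ∈ LOCC 3 3 a' b' →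
      ¬ LocallyDiscriminates M nineStates := fun _ _ _ hM =>
    not_locallyDiscriminates_of_mem_LOCC hM
  have hmem : nineStateMap ∉ LOCC 3 3 9 9 := fun h =>
    hnot 9 9 nineStateMap h locallyDiscriminates_nineStateMap
  exact ⟨nineStates_orthonormal, isInstrument_aliceOp, isInstrument_bobOp, nineStateMap_apply,
    nineStateMap_mem_LOCCStar, nineStateMap_proj_nineStates, trace_nineStateMap_proj,
    locallyDiscriminates_nineStateMap, hnot, LOCC_subset_LOCCStar, hmem,
    (LOCC_subset_LOCCStar 3 3 9 9).ssubset_of_mem_notMem nineStateMap_mem_LOCCStar hmem⟩
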